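/- Let $A$ be a finite nonempty alphabet and let $A^*$ be the set of all words on $A$. A set $S\subseteq A^*$ with $S\neq\{\varepsilon\}$ is \emph{recurrent} if it contains every factor of each of its elements and if for all $u,w\in S$ there is $v\in S$ with $uvw\in S$. A \emph{bifix code} is a set of nonempty words none of which is a proper prefix or a proper suffix of another one. For $S\subseteq A^*$, a bifix code $X\subseteq S$ is \emph{$S$-maximal} if it is not properly contained in any bifix code $Y\subseteq S$; a set $X\subseteq S$ is \emph{$S$-thin} if some word of $S$ is not a factor of any element of $X$. A \emph{parse} of a word $w$ with respect to $X$ is a triple $(v,x,u)$ with $w=vxu$ such that no suffix of $v$ is in $X$, $x\in X^*$ (the submonoid generated by $X$), and no prefix of $u$ is in $X$. The \emph{$S$-degree} of a bifix code $X$ is the supremum in $\mathbb{N}\cup\{\infty\}$, over all $w\in S$, of the number of parses of $w$ with respect to $X$. For $S=A^*$ one says thin, maximal and degree instead of $A^*$-thin, $A^*$-maximal and $A^*$-degree. Proposition. Let $S\subseteq A^*$ be a recurrent set and let $X$ be an $S$-thin and $S$-maximal bifix code of $S$-degree $d$. Then there is a thin maximal bifix code $X'\subseteq A^*$ of degree $d$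 such that $X=X'\cap S$. -/

import Mathlib

/-! Words on the alphabet `A` are lists, sets of words are of type `Set (List A)`; the prefix,
suffix and factor orders are `<+:`, `<:+` and `<:+:` (not necessarily proper). -/

namespace BifixCode

/-- A set of words is factorial if it contains the factors of its elements. -/
def IsFactorial {A : Type*} (S : Set (List A)) : Prop :=
  ∀ w ∈ S, ∀ u : List A, u <:+: w → u ∈ S

/-- A set of words `S ≠ {1}` is recurrent if it is factorial and if for all `u, w ∈ S` there is
a `v ∈ S` with `uvw ∈ S`. -/
def IsRecurrent {A : Type*} (S : Set (List A)) : Prop :=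
  S ≠ {[]} ∧ IsFactorial S ∧ ∀ u ∈ S, ∀ w ∈ S, ∃ v ∈ S, u ++ v ++ w ∈ S

/-- A set of nonempty words that contains no proper prefix of its elements. -/
def IsPrefixCode {A : Type*} (X : Set (List A)) : Prop :=
  [] ∉ X ∧ ∀ x ∈ X, ∀ y ∈ X, x <+: y → x = y

/-- A set of nonempty words that contains no proper suffix of its elements. -/
def IsSuffixCode {A : Type*} (X : Set (List A)) : Prop :=
  [] ∉ X ∧ ∀ x ∈ X, ∀ y ∈ X, x <:+ y → x = y

/-- A bifix code is both a prefix code and a suffix code. -/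
def IsBifixCode {A : Type*} (X : Set (List A)) : Prop :=
  IsPrefixCode X ∧ IsSuffixCode X

/-- `X ⊆ S` is a bifix code not properly contained in any bifix code `Y ⊆ S`. -/
def IsMaximalBifixCode {A : Type*} (S X : Set (List A)) : Prop :=
  Maximal (fun Y : Set (List A) => IsBifixCode Y ∧ Y ⊆ S) X

/-- `X ⊆ S` is `S`-thin if some word of `S` is not a factor of (an element of) `X`. -/
def IsThin {A : Type*} (S X : Set (List A)) : Prop :=
  X ⊆ S ∧ ∃ w ∈ S, ∀ x ∈ X, ¬ w <:+: x

/-- The parses `(v, x, u)` of `w` with respect to `X`: `w = vxu`, no suffix of `v` is in `X`,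
`x ∈ X*` (a product of words of `X`), and no prefix of `u` is in `X`. -/
def parses {A : Type*} (X : Set (List A)) (w : List A) : Set (List A × List A × List A) :=
  {p | w = p.1 ++ p.2.1 ++ p.2.2 ∧ (∀ s ∈ X, ¬ s <:+ p.1) ∧
    (∃ l : List (List A), (∀ y ∈ l, y ∈ X) ∧ p.2.1 = l.flatten) ∧ ∀ t ∈ X, ¬ t <+: p.2.2}

/-- The `S`-degree of `X`, finite or infinite: the maximal number of parses of a word of `S`. -/
noncomputable def degree {A : Type*} (S X : Set (List A)) : ℕ∞ :=
  ⨆ w ∈ S, (parses X w).encard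

end BifixCode

/-! A bifix code `X` is determined by its indicator, the function $L$ counting the parses of each
word. The functions arising this way are characterised by local conditions (`IsIndicator`): value 1
at the empty word, growth by 0 or 1 when a letter is added at either end, and an inequality on the
four words $u, au, ub, aub$. From such a function the code is read off as the words where the mixed
second difference is $-1$ (`codeOf`).

These conditions survive truncation $\min(n, L)$ for $n \ge 1$. Thinness and maximality in $S$ bound
$L$ on $S$; let $n$ be its maximum there, that is $d$. The code of $\min(n, L)$ has a bounded
indicator, hence is maximal and thin, with degree $n$. On $S$ nothing was truncated, and membership
of a word in the code depends only on values at its factors, so the code meets $S$ in $X$. -/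

namespace BifixCode

/-! ### Unique parsing, and parses counted by prefixes or suffixes -/

variable {A : Type*}

/-- The prefixes of `w` that have no suffix in `X`. -/
def openPrefixes (X : Set (List A)) (w : List A) : Set (List A) :=
  {v | v <+: w ∧ ∀ s ∈ X, ¬ s <:+ v}

/-- The suffixes of `w` that have no prefix in `X`. -/
def openSuffixes (X : Set (List A)) (w : List A) : Set (List A) :=
  {u | u <:+ w ∧ ∀ s ∈ X, ¬ s <+: u}

theorem exists_flatten_append {X : Set (List A)} (h : [] ∉ X) (w : List A) :
    ∃ l : List (List A), ∃ u, (∀ y ∈ l, y ∈ X) ∧ w = l.flatten ++ u ∧ ∀ t ∈ X, ¬ t <+: u := by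
  induction hn : w.length using Nat.strong_induction_on generalizing w with
  | _ n ih =>
    by_cases hw : ∃ t ∈ X, t <+: w
    · obtain ⟨t, ht, r, rfl⟩ := hw
      have ht0 : t ≠ [] := fun h0 => h (h0 ▸ ht)
      have : 0 < t.length := List.length_pos_iff.2 ht0
      obtain ⟨l, u, hl, hr, hu⟩ := ih r.length (by simp at hn; omega) r rfl
      exact ⟨t :: l, u, by simpa using ⟨ht, hl⟩, by simp [hr], hu⟩
    · push Not at hw
      exact ⟨[], w, by simp, by simp, hw⟩

theorem exists_append_flatten {X : Set (List A)} (h : [] ∉ X) (w : List A) :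
    ∃ v, ∃ l : List (List A), (∀ y ∈ l, y ∈ X) ∧ w = v ++ l.flatten ∧ ∀ t ∈ X, ¬ t <:+ v := by
  induction hn : w.length using Nat.strong_induction_on generalizing w with
  | _ n ih =>
    by_cases hw : ∃ t ∈ X, t <:+ w
    · obtain ⟨t, ht, r, rfl⟩ := hw
      have ht0 : t ≠ [] := fun h0 => h (h0 ▸ ht)
      have : 0 < t.length := List.length_pos_iff.2 ht0
      obtain ⟨v, l, hl, hr, hu⟩ := ih r.length (by simp at hn; omega) r rfl
      refine ⟨v, l ++ [t], ?_, by simp [hr], hu⟩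
      simp only [List.mem_append, List.mem_singleton]
      rintro y (hy | rfl)
      exacts [hl y hy, ht]
    · push Not at hw
      exact ⟨w, [], by simp, by simp, hw⟩

theorem flatten_append_unique {X : Set (List A)} (hX : IsPrefixCode X) :
    ∀ (l m : List (List A)) (u v : List A), (∀ y ∈ l, y ∈ X) → (∀ y ∈ m, y ∈ X) →
      (∀ t ∈ X, ¬ t <+: u) → (∀ t ∈ X, ¬ t <+: v) →
      l.flatten ++ u = m.flatten ++ v → l.flatten = m.flatten ∧ u = v
  | [], [], u, v, _, _, _, _, h => by simpa using h
  | [], y :: m, u, v, _, hm, hu, _, h => by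
    refine absurd ⟨m.flatten ++ v, ?_⟩ (hu y (hm y (by simp)))
    simpa using h.symm
  | x :: l, [], u, v, hl, _, _, hv, h => by
    refine absurd ⟨l.flatten ++ u, ?_⟩ (hv x (hl x (by simp)))
    simpa using h
  | x :: l, y :: m, u, v, hl, hm, hu, hv, h => by
    simp only [List.flatten_cons, List.append_assoc] at h
    have hx := hl x (by simp)
    have hy := hm y (by simp)
    have hxy : x = y := by
      rcases List.prefix_or_prefix_of_prefix (List.prefix_append x (l.flatten ++ u))
        (h ▸ List.prefix_append y (m.flatten ++ v)) with h1 | h1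
      · exact hX.2 x hx y hy h1
      · exact (hX.2 y hy x hx h1).symm
    subst hxy
    obtain ⟨h1, h2⟩ := flatten_append_unique hX l m u v (fun y hy => hl y (by simp [hy]))
      (fun y hy => hm y (by simp [hy])) hu hv (List.append_cancel_left h)
    exact ⟨by simp [h1], h2⟩

theorem isPrefixCode_reverse {X : Set (List A)} (hX : IsSuffixCode X) :
    IsPrefixCode {w | w.reverse ∈ X} := by
  refine ⟨by simpa using hX.1, fun x hx y hy h => ?_⟩
  exact List.reverse_injective (hX.2 _ hx _ hy (List.reverse_suffix.2 h))

theorem append_flatten_unique {X : Set (List A)} (hX : IsSuffixCode X)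
    (l m : List (List A)) (u v : List A) (hl : ∀ y ∈ l, y ∈ X) (hm : ∀ y ∈ m, y ∈ X)
    (hu : ∀ t ∈ X, ¬ t <:+ u) (hv : ∀ t ∈ X, ¬ t <:+ v)
    (h : u ++ l.flatten = v ++ m.flatten) : u = v ∧ l.flatten = m.flatten := by
  have key := flatten_append_unique (isPrefixCode_reverse hX) (l.map List.reverse).reverse
    (m.map List.reverse).reverse u.reverse v.reverse
    (fun y hy => hl _ (by simpa using hy)) (fun y hy => hm _ (by simpa using hy))
    (fun t ht h => hu _ ht (by simpa using List.reverse_suffix.2 h))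
    (fun t ht h => hv _ ht (by simpa using List.reverse_suffix.2 h))
    (by
      rw [← List.reverse_flatten, ← List.reverse_flatten, ← List.reverse_append,
        ← List.reverse_append, h])
  rw [← List.reverse_flatten, ← List.reverse_flatten] at key
  exact ⟨List.reverse_injective key.2, List.reverse_injective key.1⟩

/-- A parse is determined by its first component: the remainder of the word factors greedily, and
uniquely, into words of `X` followed by a tail with no prefix in `X`. -/
theorem encard_parses_eq_openPrefixes {X : Set (List A)} (hX : IsPrefixCode X) (w : List A) :
    (parses X w).encard = (openPrefixes X w).encard := by
  have hinj : Set.InjOn (fun p : List A × List A × List A => p.1) (parses X w) := by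
    rintro ⟨v, x, u⟩ ⟨h1, _, ⟨l, hl, hx⟩, hu⟩ ⟨v', x', u'⟩ ⟨h1', _, ⟨l', hl', hx'⟩, hu'⟩ hv
    simp only at *
    subst hv hx hx'
    rw [h1, List.append_assoc, List.append_assoc] at h1'
    obtain ⟨h2, h3⟩ := flatten_append_unique hX l l' u u' hl hl' hu hu'
      (List.append_cancel_left h1')
    rw [h2, h3]
  rw [← hinj.encard_image]
  congr 1
  ext v
  constructor
  · rintro ⟨⟨v, x, u⟩, ⟨h1, h2, -⟩, rfl⟩
    exact ⟨⟨x ++ u, by simpa using h1.symm⟩, h2⟩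
  · rintro ⟨⟨r, rfl⟩, h2⟩
    obtain ⟨l, u, hl, rfl, hu⟩ := exists_flatten_append hX.1 r
    exact ⟨(v, l.flatten, u), ⟨by simp, h2, ⟨l, hl, rfl⟩, hu⟩, rfl⟩

theorem encard_parses_eq_openSuffixes {X : Set (List A)} (hX : IsSuffixCode X) (w : List A) :
    (parses X w).encard = (openSuffixes X w).encard := by
  have hinj : Set.InjOn (fun p : List A × List A × List A => p.2.2) (parses X w) := by
    rintro ⟨v, x, u⟩ ⟨h1, hv, ⟨l, hl, hx⟩, _⟩ ⟨v', x', u'⟩ ⟨h1', hv', ⟨l', hl', hx'⟩, _⟩ hu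
    simp only at *
    subst hu hx hx'
    rw [h1] at h1'
    obtain ⟨h2, h3⟩ := append_flatten_unique hX l l' v v' hl hl' hv hv'
      (List.append_cancel_right h1')
    rw [h2, h3]
  rw [← hinj.encard_image]
  congr 1
  ext u
  constructor
  · rintro ⟨⟨v, x, u⟩, ⟨h1, -, -, h2⟩, rfl⟩
    exact ⟨⟨v ++ x, h1.symm⟩, h2⟩
  · rintro ⟨⟨r, rfl⟩, h2⟩
    obtain ⟨v, l, hl, rfl, hv⟩ := exists_append_flatten hX.1 r
    exact ⟨(v, l.flatten, u), ⟨by simp, hv, ⟨l, hl, rfl⟩, h2⟩, rfl⟩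

theorem finite_openPrefixes (X : Set (List A)) (w : List A) : (openPrefixes X w).Finite :=
  (List.finite_toSet w.inits).subset fun _ hv => (List.mem_inits _ _).2 hv.1

theorem finite_openSuffixes (X : Set (List A)) (w : List A) : (openSuffixes X w).Finite :=
  (List.finite_toSet w.tails).subset fun _ hv => (List.mem_tails _ _).2 hv.1

/-! ### The indicator and its increments -/

/-- The number of parses of a word. -/
noncomputable def indicator (X : Set (List A)) (w : List A) : ℕ := (parses X w).ncard

theorem indicator_eq_openPrefixes {X : Set (List A)} (hX : IsPrefixCode X) (w : List A) :
    indicator X w = (openPrefixes X w).ncard := by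
  rw [indicator, Set.ncard, Set.ncard, encard_parses_eq_openPrefixes hX]

theorem indicator_eq_openSuffixes {X : Set (List A)} (hX : IsSuffixCode X) (w : List A) :
    indicator X w = (openSuffixes X w).ncard := by
  rw [indicator, Set.ncard, Set.ncard, encard_parses_eq_openSuffixes hX]

theorem encard_parses {X : Set (List A)} (hX : IsPrefixCode X) (w : List A) :
    (parses X w).encard = indicator X w := by
  rw [indicator_eq_openPrefixes hX, encard_parses_eq_openPrefixes hX,
    (finite_openPrefixes X w).cast_ncard_eq]

theorem indicator_nil {X : Set (List A)} (hX : IsPrefixCode X) : indicator X [] = 1 := by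
  rw [indicator_eq_openPrefixes hX]
  have : openPrefixes X [] = {[]} := by
    ext v
    simp only [openPrefixes, List.prefix_nil, Set.mem_ofPred_eq, Set.mem_singleton_iff]
    refine ⟨fun h => h.1, ?_⟩
    rintro rfl
    exact ⟨rfl, fun s hs h => hX.1 (List.suffix_nil.1 h ▸ hs)⟩
  rw [this, Set.ncard_singleton]

open Classical in
theorem indicator_concat {X : Set (List A)} (hX : IsPrefixCode X) (w : List A) (a : A) :
    indicator X (w ++ [a]) =
      indicator X w + if ∃ s ∈ X, s <:+ w ++ [a] then 0 else 1 := by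
  rw [indicator_eq_openPrefixes hX, indicator_eq_openPrefixes hX]
  split_ifs with h
  · congr 1
    ext v
    simp only [openPrefixes, Set.mem_ofPred_eq, List.prefix_concat_iff]
    constructor
    · rintro ⟨rfl | h1, h2⟩
      · obtain ⟨s, hs, h⟩ := h
        exact absurd h (h2 s hs)
      · exact ⟨h1, h2⟩
    · exact fun h => ⟨Or.inr h.1, h.2⟩
  · have : openPrefixes X (w ++ [a]) = insert (w ++ [a]) (openPrefixes X w) := by
      ext v
      simp only [openPrefixes, Set.mem_ofPred_eq, List.prefix_concat_iff, Set.mem_insert_iff]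
      constructor
      · rintro ⟨rfl | h1, h2⟩
        · exact Or.inl rfl
        · exact Or.inr ⟨h1, h2⟩
      · rintro (rfl | ⟨h1, h2⟩)
        · exact ⟨Or.inl rfl, fun s hs hw => h ⟨s, hs, hw⟩⟩
        · exact ⟨Or.inr h1, h2⟩
    rw [this, Set.ncard_insert_of_notMem _ (finite_openPrefixes X w)]
    intro h1
    simpa using h1.1.length_le

open Classical in
theorem indicator_cons {X : Set (List A)} (hX : IsSuffixCode X) (w : List A) (a : A) :
    indicator X (a :: w) =
      indicator X w + if ∃ s ∈ X, s <+: a :: w then 0 else 1 := by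
  rw [indicator_eq_openSuffixes hX, indicator_eq_openSuffixes hX]
  split_ifs with h
  · congr 1
    ext v
    simp only [openSuffixes, Set.mem_ofPred_eq, List.suffix_cons_iff]
    constructor
    · rintro ⟨rfl | h1, h2⟩
      · obtain ⟨s, hs, h⟩ := h
        exact absurd h (h2 s hs)
      · exact ⟨h1, h2⟩
    · exact fun h => ⟨Or.inr h.1, h.2⟩
  · have : openSuffixes X (a :: w) = insert (a :: w) (openSuffixes X w) := by
      ext v
      simp only [openSuffixes, Set.mem_ofPred_eq, List.suffix_cons_iff, Set.mem_insert_iff]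
      constructor
      · rintro ⟨rfl | h1, h2⟩
        · exact Or.inl rfl
        · exact Or.inr ⟨h1, h2⟩
      · rintro (rfl | ⟨h1, h2⟩)
        · exact ⟨Or.inl rfl, fun s hs hw => h ⟨s, hs, hw⟩⟩
        · exact ⟨Or.inr h1, h2⟩
    rw [this, Set.ncard_insert_of_notMem _ (finite_openSuffixes X w)]
    intro h1
    simpa using h1.1.length_le

/-! ### Axioms for indicators and truncation -/

/-- The properties that characterise the functions counting the parses with respect to a
bifix code. -/
structure IsIndicator (f : List A → ℕ) : Prop where
  nil : f [] = 1
  le_concat : ∀ u a, f u ≤ f (u ++ [a])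
  concat_le : ∀ u a, f (u ++ [a]) ≤ f u + 1
  le_cons : ∀ a u, f u ≤ f (a :: u)
  cons_le : ∀ a u, f (a :: u) ≤ f u + 1
  submodular : ∀ a u b, f u + f (a :: (u ++ [b])) ≤ f (a :: u) + f (u ++ [b])

theorem isIndicator_indicator {X : Set (List A)} (hX : IsBifixCode X) :
    IsIndicator (indicator X) where
  nil := indicator_nil hX.1
  le_concat u a := by rw [indicator_concat hX.1]; omega
  concat_le u a := by rw [indicator_concat hX.1]; split_ifs <;> omega
  le_cons a u := by rw [indicator_cons hX.2]; omega
  cons_le a u := by rw [indicator_cons hX.2]; split_ifs <;> omega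
  submodular a u b := by
    rw [← List.cons_append, indicator_concat hX.1 (a :: u), indicator_concat hX.1 u]
    split_ifs with h1 h2 h2
    · omega
    · omega
    · obtain ⟨s, hs, h⟩ := h2
      exact absurd ⟨s, hs, h.trans (List.suffix_cons a _)⟩ h1
    · omega

/-- For submodularity: if $n \le f(u)$, all four values become $n$. Otherwise $f(au), f(ub) \le f(u)
+ 1 \le n$ are unchanged, and truncation can only lower the left side. -/
theorem IsIndicator.min {f : List A → ℕ} (hf : IsIndicator f) {n : ℕ} (hn : 1 ≤ n) :
    IsIndicator (fun w => min n (f w)) where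
  nil := by simp [hf.nil, hn]
  le_concat u a := by have := hf.le_concat u a; omega
  concat_le u a := by have := hf.concat_le u a; omega
  le_cons a u := by have := hf.le_cons a u; omega
  cons_le a u := by have := hf.cons_le a u; omega
  submodular a u b := by
    have := hf.submodular a u b
    have := hf.le_concat u b
    have := hf.concat_le u b
    have := hf.le_cons a u
    have := hf.cons_le a u
    have := hf.le_cons a (u ++ [b])
    have := hf.le_concat (a :: u) b
    rw [List.cons_append] at this
    omega

theorem IsIndicator.le_append_right {f : List A → ℕ} (hf : IsIndicator f) (u v : List A) :
    f u ≤ f (u ++ v) := by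
  induction v using List.reverseRecOn with
  | nil => simp
  | append_singleton v a ih =>
    rw [← List.append_assoc]
    exact ih.trans (hf.le_concat _ _)

theorem IsIndicator.le_append_left {f : List A → ℕ} (hf : IsIndicator f) (u v : List A) :
    f v ≤ f (u ++ v) := by
  induction u with
  | nil => simp
  | cons a u ih => exact ih.trans (hf.le_cons _ _)

/-! ### Recovering a bifix code from its indicator -/

/-- The bifix code whose parses are counted by `f`. -/
def codeOf (f : List A → ℕ) : Set (List A) :=
  {w | (∃ a, w = [a] ∧ f [a] = 1) ∨ ∃ a u b, w = a :: (u ++ [b]) ∧ f (a :: (u ++ [b])) = f u + 1 ∧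
    f (a :: u) = f u + 1 ∧ f (u ++ [b]) = f u + 1}

theorem cons_append_singleton_inj {a a' b b' : A} {u u' : List A}
    (h : a :: (u ++ [b]) = a' :: (u' ++ [b'])) : a = a' ∧ u = u' ∧ b = b' := by
  simp only [List.cons.injEq] at h
  obtain ⟨h1, h2⟩ := h
  obtain ⟨h3, h4⟩ := List.append_inj' h2 rfl
  exact ⟨h1, h3, by simpa using h4⟩

theorem singleton_mem_codeOf {f : List A → ℕ} {a : A} : [a] ∈ codeOf f ↔ f [a] = 1 := by
  constructor
  · rintro (⟨b, h, hb⟩ | ⟨b, u, c, h, -⟩)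
    · simp only [List.cons.injEq, and_true] at h
      rwa [h]
    · simp at h
  · exact fun h => Or.inl ⟨a, rfl, h⟩

theorem cons_append_mem_codeOf {f : List A → ℕ} {a b : A} {u : List A} :
    a :: (u ++ [b]) ∈ codeOf f ↔
      f (a :: (u ++ [b])) = f u + 1 ∧ f (a :: u) = f u + 1 ∧ f (u ++ [b]) = f u + 1 := by
  constructor
  · rintro (⟨c, h, -⟩ | ⟨a', u', b', h, h'⟩)
    · simp at h
    · obtain ⟨rfl, rfl, rfl⟩ := cons_append_singleton_inj h
      exact h'
  · exact fun h => Or.inr ⟨a, u, b, rfl, h⟩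

theorem word_cases (w : List A) : w = [] ∨ (∃ a, w = [a]) ∨ ∃ a u b, w = a :: (u ++ [b]) := by
  rcases w with _ | ⟨a, w⟩
  · exact Or.inl rfl
  · rcases List.eq_nil_or_concat w with rfl | ⟨u, b, rfl⟩
    · exact Or.inr (Or.inl ⟨a, rfl⟩)
    · exact Or.inr (Or.inr ⟨a, u, b, by simp⟩)

theorem nil_notMem_codeOf (f : List A → ℕ) : [] ∉ codeOf f := by
  rintro (⟨a, h, -⟩ | ⟨a, u, b, h, -⟩) <;> simp at h

/-- The increment $f(ub) - f(u)$ is 0 or 1 and, by submodularity, cannot increase as $u$ is extended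
to the left. The word at which it drops from 1 to 0 is exactly a word of the code. -/
theorem IsIndicator.exists_suffix_mem_codeOf_iff {f : List A → ℕ} (hf : IsIndicator f)
    (u : List A) (b : A) :
    (∃ s ∈ codeOf f, s <:+ u ++ [b]) ↔ f (u ++ [b]) = f u := by
  induction u with
  | nil =>
    rw [hf.nil, List.nil_append, ← singleton_mem_codeOf]
    constructor
    · rintro ⟨s, hs, h⟩
      rcases List.suffix_cons_iff.1 h with rfl | h
      · exact hs
      · exact absurd (List.suffix_nil.1 h ▸ hs) (nil_notMem_codeOf f)
    · exact fun h => ⟨_, h, List.suffix_rfl⟩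
  | cons a u ih =>
    have h1 := hf.submodular a u b
    have h2 := hf.le_concat u b
    have h3 := hf.concat_le u b
    have h4 := hf.cons_le a u
    have h5 := hf.le_cons a (u ++ [b])
    have h6 := hf.le_concat (a :: u) b
    rw [List.cons_append] at h6 ⊢
    constructor
    · rintro ⟨s, hs, h⟩
      rcases List.suffix_cons_iff.1 h with rfl | h
      · rw [cons_append_mem_codeOf] at hs
        omega
      · have := ih.1 ⟨s, hs, h⟩
        omega
    · intro h
      by_cases h7 : f (u ++ [b]) = f u
      · obtain ⟨s, hs, h8⟩ := ih.2 h7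
        exact ⟨s, hs, h8.trans (List.suffix_cons _ _)⟩
      · exact ⟨_, cons_append_mem_codeOf.2 ⟨by omega, by omega, by omega⟩, List.suffix_rfl⟩

theorem IsIndicator.exists_prefix_mem_codeOf_iff {f : List A → ℕ} (hf : IsIndicator f)
    (a : A) (u : List A) :
    (∃ s ∈ codeOf f, s <+: a :: u) ↔ f (a :: u) = f u := by
  induction u using List.reverseRecOn with
  | nil =>
    rw [hf.nil, ← singleton_mem_codeOf]
    constructor
    · rintro ⟨s, hs, h⟩
      rcases List.prefix_concat_iff (l₂ := []).1 h with rfl | h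
      · exact hs
      · exact absurd (List.prefix_nil.1 h ▸ hs) (nil_notMem_codeOf f)
    · exact fun h => ⟨_, h, List.prefix_rfl⟩
  | append_singleton u b ih =>
    have h1 := hf.submodular a u b
    have h2 := hf.le_cons a u
    have h3 := hf.cons_le a u
    have h4 := hf.concat_le u b
    have h5 := hf.le_cons a (u ++ [b])
    have h6 := hf.le_concat (a :: u) b
    rw [List.cons_append] at h6
    constructor
    · rintro ⟨s, hs, h⟩
      rw [← List.cons_append] at h
      rcases List.prefix_concat_iff.1 h with rfl | h
      · rw [List.cons_append, cons_append_mem_codeOf] at hs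
        omega
      · have := ih.1 ⟨s, hs, h⟩
        omega
    · intro h
      by_cases h7 : f (a :: u) = f u
      · obtain ⟨s, hs, h8⟩ := ih.2 h7
        refine ⟨s, hs, h8.trans ?_⟩
        rw [← List.cons_append]
        exact List.prefix_append _ _
      · exact ⟨_, cons_append_mem_codeOf.2 ⟨by omega, by omega, by omega⟩, List.prefix_rfl⟩

theorem IsIndicator.isBifixCode_codeOf {f : List A → ℕ} (hf : IsIndicator f) :
    IsBifixCode (codeOf f) := by
  refine ⟨⟨nil_notMem_codeOf f, fun x hx y hy h => ?_⟩, nil_notMem_codeOf f, fun x hx y hy h => ?_⟩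
  · by_contra hne
    rcases word_cases y with rfl | ⟨a, rfl⟩ | ⟨a, u, b, rfl⟩
    · exact nil_notMem_codeOf f hy
    · rcases List.prefix_concat_iff (l₂ := []).1 h with rfl | h
      · exact hne rfl
      · exact nil_notMem_codeOf f (List.prefix_nil.1 h ▸ hx)
    · rw [← List.cons_append] at h hne
      rcases List.prefix_concat_iff.1 h with rfl | h
      · exact hne rfl
      · have h1 := (hf.exists_prefix_mem_codeOf_iff a u).1 ⟨x, hx, h⟩
        have h2 := cons_append_mem_codeOf.1 hy
        omega
  · by_contra hne
    rcases word_cases y with rfl | ⟨a, rfl⟩ | ⟨a, u, b, rfl⟩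
    · exact nil_notMem_codeOf f hy
    · rcases List.suffix_cons_iff.1 h with rfl | h
      · exact hne rfl
      · exact nil_notMem_codeOf f (List.suffix_nil.1 h ▸ hx)
    · rcases List.suffix_cons_iff.1 h with rfl | h
      · exact hne rfl
      · have h1 := (hf.exists_suffix_mem_codeOf_iff u b).1 ⟨x, hx, h⟩
        have h2 := cons_append_mem_codeOf.1 hy
        omega

theorem IsIndicator.indicator_codeOf {f : List A → ℕ} (hf : IsIndicator f) (w : List A) :
    indicator (codeOf f) w = f w := by
  induction w using List.reverseRecOn with
  | nil => rw [indicator_nil hf.isBifixCode_codeOf.1, hf.nil]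
  | append_singleton u b ih =>
    have h1 := hf.le_concat u b
    have h2 := hf.concat_le u b
    rw [indicator_concat hf.isBifixCode_codeOf.1, ih, hf.exists_suffix_mem_codeOf_iff]
    split_ifs with h <;> omega

theorem codeOf_indicator {X : Set (List A)} (hX : IsBifixCode X) :
    codeOf (indicator X) = X := by
  ext w
  rcases word_cases w with rfl | ⟨a, rfl⟩ | ⟨a, u, b, rfl⟩
  · exact iff_of_false (nil_notMem_codeOf _) hX.1.1
  · rw [singleton_mem_codeOf, indicator_cons hX.2, indicator_nil hX.1]
    constructor
    · intro h
      have h1 : ∃ s ∈ X, s <+: [a] := by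
        by_contra h1
        rw [if_neg h1] at h
        omega
      obtain ⟨s, hs, h⟩ := h1
      rcases List.prefix_concat_iff (l₂ := []).1 h with rfl | h
      · exact hs
      · exact absurd (List.prefix_nil.1 h ▸ hs) hX.1.1
    · intro h
      rw [if_pos ⟨_, h, List.prefix_rfl⟩]
  · rw [cons_append_mem_codeOf]
    have e := indicator_concat hX.1 (a :: u) b
    rw [List.cons_append] at e
    rw [e, indicator_concat hX.1 u b, indicator_cons hX.2 u a]
    constructor
    · rintro ⟨h1, h2, h3⟩
      have h5 : ¬ ∃ s ∈ X, s <:+ u ++ [b] := by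
        intro h5
        rw [if_pos h5] at h3
        omega
      have hs : ∃ s ∈ X, s <:+ a :: (u ++ [b]) := by
        by_contra hs
        rw [if_neg hs] at h1
        omega
      obtain ⟨s, hs, h⟩ := hs
      rcases List.suffix_cons_iff.1 h with rfl | h
      · exact hs
      · exact absurd ⟨s, hs, h⟩ h5
    · intro h
      have hp : ¬ ∃ s ∈ X, s <+: a :: u := by
        rintro ⟨s, hs, h1⟩
        have h3 : a :: u <+: a :: (u ++ [b]) := ⟨[b], by simp⟩
        have h2 := hX.1.2 s hs _ h (h1.trans h3)
        have := h1.length_le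
        simp [h2] at this
      have hq : ¬ ∃ s ∈ X, s <:+ u ++ [b] := by
        rintro ⟨s, hs, h1⟩
        have h2 := hX.2.2 s hs _ h (h1.trans (List.suffix_cons _ _))
        have := h1.length_le
        simp [h2] at this
      rw [if_neg hp, if_neg hq, if_pos ⟨_, h, List.suffix_rfl⟩]
      exact ⟨rfl, rfl, rfl⟩

/-- Membership of $w$ only involves values at factors of $w$, which stay in `S`. -/
theorem codeOf_inter_congr {S : Set (List A)} (hS : IsFactorial S) {f g : List A → ℕ}
    (h : ∀ w ∈ S, f w = g w) : codeOf f ∩ S = codeOf g ∩ S := by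
  ext w
  refine and_congr_left fun hw => ?_
  rcases word_cases w with rfl | ⟨a, rfl⟩ | ⟨a, u, b, rfl⟩
  · exact iff_of_false (nil_notMem_codeOf _) (nil_notMem_codeOf _)
  · rw [singleton_mem_codeOf, singleton_mem_codeOf, h _ hw]
  · rw [cons_append_mem_codeOf, cons_append_mem_codeOf, h _ hw,
      h _ (hS _ hw u ⟨[a], [b], by simp⟩), h _ (hS _ hw (a :: u) ⟨[], [b], by simp⟩),
      h _ (hS _ hw (u ++ [b]) ⟨[a], [], by simp⟩)]

theorem degree_eq_iSup_indicator {S X : Set (List A)} (hX : IsPrefixCode X) :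
    degree S X = ⨆ w ∈ S, (indicator X w : ℕ∞) := by
  simp only [degree, encard_parses hX]

/-! ### Thinness and maximality from a bounded indicator -/

/-- A bounded indicator that attains its bound is that of a thin code. -/
theorem IsIndicator.isThin_codeOf [Nonempty A] {f : List A → ℕ} (hf : IsIndicator f) {n : ℕ}
    (hn : ∀ w, f w ≤ n) {w : List A} (hw : f w = n) : IsThin Set.univ (codeOf f) := by
  obtain ⟨c⟩ := ‹Nonempty A›
  -- The padding letters ensure that a code word $aub$ containing $cwc$ has $w$ inside $u$. Then
  -- $f(u) = n$ already, which excludes $f(au) = f(u) + 1$.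
  refine ⟨Set.subset_univ _, c :: (w ++ [c]), Set.mem_univ _, ?_⟩
  rintro x hx ⟨p, s, rfl⟩
  have key : ∀ p s, f (p ++ w ++ s) = n := fun p s => le_antisymm (hn _) (hw ▸
    (hf.le_append_left p w).trans (hf.le_append_right _ s))
  rcases word_cases (p ++ c :: (w ++ [c]) ++ s) with h | ⟨a, h⟩ | ⟨a, u, b, h⟩
  · simp at h
  · have := congrArg List.length h
    simp at this
    omega
  · rw [h, cons_append_mem_codeOf] at hx
    obtain ⟨p', s', rfl⟩ : ∃ p' s', u = p' ++ w ++ s' := by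
      rcases p with _ | ⟨a', p⟩ <;> rcases List.eq_nil_or_concat s with rfl | ⟨s, b', rfl⟩
      · exact ⟨[], [], (cons_append_singleton_inj (a := a) (b := b) (a' := c) (b' := c)
          (by simpa using h.symm)).2.1⟩
      · refine ⟨[], c :: s, (cons_append_singleton_inj (a := a) (b := b) (a' := c) (b' := b') ?_).2.1⟩
        simpa using h.symm
      · refine ⟨p ++ [c], [], (cons_append_singleton_inj (a := a) (b := b) (a' := a') (b' := c) ?_).2.1⟩
        simpa using h.symm
      · refine ⟨p ++ [c], c :: s,
          (cons_append_singleton_inj (a := a) (b := b) (a' := a') (b' := b') ?_).2.1⟩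
        simpa using h.symm
    have h1 := key p' s'
    have h2 := hn (a :: (p' ++ w ++ s'))
    omega

/-- A bifix code with respect to which the number of parses is bounded is maximal. -/
theorem isMaximalBifixCode_univ_of_indicator_le {X : Set (List A)} (hX : IsBifixCode X) {n : ℕ}
    (hn : ∀ w, indicator X w ≤ n) : IsMaximalBifixCode Set.univ X := by
  refine ⟨⟨hX, Set.subset_univ _⟩, fun Y hY hXY y hy => ?_⟩
  by_contra hyX
  -- The word $y$ is not suffix-comparable with any word of `X`, so each further copy of $y$ adds a
  -- parse, and the powers of $y$ break the bound.
  have key : ∀ k, k + 1 ≤ indicator X (List.replicate k y).flatten := by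
    intro k
    induction k with
    | zero => simp [indicator_nil hX.1]
    | succ k ih =>
      rcases List.eq_nil_or_concat y with rfl | ⟨z, b, rfl⟩
      · exact absurd hy hY.1.1.1
      · rw [List.concat_eq_append] at *
        rw [List.replicate_succ', List.flatten_concat, ← List.append_assoc,
          indicator_concat hX.1, if_neg]
        · have := (isIndicator_indicator hX).le_append_right
            (List.replicate k (z ++ [b])).flatten z
          omega
        · rintro ⟨s, hs, h⟩
          rw [List.append_assoc] at h
          rcases List.suffix_or_suffix_of_suffix h (List.suffix_append _ _) with h1 | h1
          · exact hyX (hY.1.2.2 s (hXY hs) _ hy h1 ▸ hs)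
          · exact hyX (hY.1.2.2 _ hy s (hXY hs) h1 ▸ hs)
  have := key n
  have := hn (List.replicate n y).flatten
  omega

/-! ### Finiteness of the degree in a recurrent set -/

theorem ncard_prefixes_length_le (w : List A) (n : ℕ) {T : Set (List A)}
    (hT : ∀ v ∈ T, v <+: w ∧ v.length ≤ n) : T.ncard ≤ n + 1 := by
  have hinj : Set.InjOn List.length T := by
    intro u hu v hv h
    rw [List.prefix_iff_eq_take.1 (hT u hu).1, List.prefix_iff_eq_take.1 (hT v hv).1, h]
  rw [← hinj.ncard_image]
  refine (Set.ncard_le_ncard (t := (Finset.range (n + 1) : Set ℕ)) ?_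
    (Finset.finite_toSet _)).trans (by simp)
  rintro _ ⟨v, hv, rfl⟩
  simpa using Nat.lt_succ_of_le (hT v hv).2

theorem ncard_suffixes_length_le (w : List A) (n : ℕ) {T : Set (List A)}
    (hT : ∀ v ∈ T, v <:+ w ∧ v.length ≤ n) : T.ncard ≤ n + 1 := by
  rw [← Set.ncard_image_of_injective T List.reverse_injective]
  refine ncard_prefixes_length_le w.reverse n ?_
  rintro _ ⟨v, hv, rfl⟩
  simpa using hT v hv

/-- If `X` is maximal among the bifix codes in a recurrent set `S`, then all the words of `S` are
comparable with words of `X` for the prefix order, or all are for the suffix order. -/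
theorem IsMaximalBifixCode.comparable {S X : Set (List A)} (hS : IsRecurrent S)
    (hX : IsMaximalBifixCode S X) (hne : X.Nonempty) :
    (∀ y ∈ S, ∃ x ∈ X, x <+: y ∨ y <+: x) ∨ ∀ z ∈ S, ∃ x ∈ X, x <:+ z ∨ z <:+ x := by
  by_contra! h
  obtain ⟨⟨y, hyS, hy⟩, z, hzS, hz⟩ := h
  -- Here $y$ is prefix-incomparable and $z$ suffix-incomparable with `X`. Hence $yvz$ is
  -- incomparable on both sides, and adjoining it contradicts maximality.
  obtain ⟨v, -, hv⟩ := hS.2.2 y hyS z hzS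
  obtain ⟨x₀, hx₀⟩ := hne
  have hy0 : y ≠ [] := by
    rintro rfl
    exact (hy x₀ hx₀).2 List.nil_prefix
  have hpre : y <+: y ++ v ++ z := ⟨v ++ z, by simp⟩
  have hsuf : z <:+ y ++ v ++ z := List.suffix_append _ _
  have p1 : ∀ x ∈ X, ¬ x <+: y ++ v ++ z := fun x hx h =>
    (List.prefix_or_prefix_of_prefix h hpre).elim (hy x hx).1 (hy x hx).2
  have p2 : ∀ x ∈ X, ¬ y ++ v ++ z <+: x := fun x hx h => (hy x hx).2 (hpre.trans h)
  have s1 : ∀ x ∈ X, ¬ x <:+ y ++ v ++ z := fun x hx h =>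
    (List.suffix_or_suffix_of_suffix h hsuf).elim (hz x hx).1 (hz x hx).2
  have s2 : ∀ x ∈ X, ¬ y ++ v ++ z <:+ x := fun x hx h => (hz x hx).2 (hsuf.trans h)
  have hb : IsBifixCode (insert (y ++ v ++ z) X) := by
    have hnil : [] ∉ insert (y ++ v ++ z) X := by
      rintro (h | h)
      · simp [hy0] at h
      · exact hX.1.1.1.1 h
    refine ⟨⟨hnil, ?_⟩, hnil, ?_⟩
    · rintro x (rfl | hx) x' (rfl | hx') h
      · rfl
      · exact absurd h (p2 x' hx')
      · exact absurd h (p1 x hx)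
      · exact hX.1.1.1.2 x hx x' hx' h
    · rintro x (rfl | hx) x' (rfl | hx') h
      · rfl
      · exact absurd h (s2 x' hx')
      · exact absurd h (s1 x hx)
      · exact hX.1.1.2.2 x hx x' hx' h
  have hmem := hX.2 ⟨hb, Set.insert_subset hv hX.1.2⟩ (Set.subset_insert _ _)
    (Set.mem_insert _ _)
  exact p1 _ hmem List.prefix_rfl

theorem IsMaximalBifixCode.nonempty {S X : Set (List A)} (hS : IsRecurrent S)
    (hne : S.Nonempty) (hX : IsMaximalBifixCode S X) : X.Nonempty := by
  by_contra h
  rw [Set.not_nonempty_iff_eq_empty] at h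
  subst h
  obtain ⟨y, hy, hy0⟩ : ∃ y ∈ S, y ≠ [] := by
    by_contra! h
    exact hS.1 (Set.eq_singleton_iff_nonempty_unique_mem.2 ⟨hne, h⟩)
  have hb : IsBifixCode {y} := by
    refine ⟨⟨by simpa using hy0.symm, ?_⟩, by simpa using hy0.symm, ?_⟩ <;>
    · rintro x rfl x' rfl -
      rfl
  exact hX.2 ⟨hb, by simpa using hy⟩ (Set.empty_subset _) (Set.mem_singleton y)

/-- A thin maximal bifix code in a recurrent set has finite degree. -/
theorem IsMaximalBifixCode.exists_indicator_le {S X : Set (List A)} (hS : IsRecurrent S)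
    (hX : IsMaximalBifixCode S X) (hthin : IsThin S X) :
    ∃ n, ∀ w ∈ S, indicator X w ≤ n := by
  obtain ⟨-, w, hw, hwX⟩ := hthin
  have hI := isIndicator_indicator hX.1.1
  refine ⟨w.length + 1, fun u hu => ?_⟩
  rcases hX.comparable hS (hX.nonempty hS ⟨w, hw⟩) with h | h
  · obtain ⟨v, -, hv⟩ := hS.2.2 u hu w hw
    refine (hI.le_append_right u (v ++ w)).trans ?_
    rw [← List.append_assoc, indicator_eq_openSuffixes hX.1.1.2]
    refine ncard_suffixes_length_le (u ++ v ++ w) _ fun t ht => ⟨ht.1, ?_⟩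
    by_contra! hlt
    obtain ⟨x, hx, h1 | h1⟩ := h t (hS.2.1 _ hv _ ht.1.isInfix)
    · exact ht.2 x hx h1
    · exact hwX x hx ((List.suffix_of_suffix_length_le (List.suffix_append _ _) ht.1
        hlt.le).isInfix.trans h1.isInfix)
  · obtain ⟨v, -, hv⟩ := hS.2.2 w hw u hu
    refine (hI.le_append_left (w ++ v) u).trans ?_
    rw [indicator_eq_openPrefixes hX.1.1.1]
    refine ncard_prefixes_length_le (w ++ v ++ u) _ fun t ht => ⟨ht.1, ?_⟩
    by_contra! hlt
    obtain ⟨x, hx, h1 | h1⟩ := h t (hS.2.1 _ hv _ ht.1.isInfix)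
    · exact ht.2 x hx h1
    · exact hwX x hx ((List.prefix_of_prefix_length_le ⟨v ++ u, by simp⟩ ht.1
        hlt.le).isInfix.trans h1.isInfix)

theorem exists_max_of_bounded {S : Set (List A)} (hS : S.Nonempty) {f : List A → ℕ} {n : ℕ}
    (hn : ∀ w ∈ S, f w ≤ n) : ∃ w ∈ S, ∀ u ∈ S, f u ≤ f w := by
  have hfin : (f '' S).Finite := (Set.finite_Iic n).subset (by rintro _ ⟨w, hw, rfl⟩; exact hn w hw)
  obtain ⟨_, ⟨w, hw, rfl⟩, h⟩ := hfin.exists_maximal (hS.image f)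
  refine ⟨w, hw, fun u hu => ?_⟩
  by_contra! hlt
  exact absurd (h (Set.mem_image_of_mem f hu) hlt.le) (not_le.2 hlt)

theorem degree_eq_of_max {S X : Set (List A)} (hX : IsPrefixCode X) {w : List A} (hw : w ∈ S)
    (h : ∀ u ∈ S, indicator X u ≤ indicator X w) : degree S X = indicator X w := by
  rw [degree_eq_iSup_indicator hX]
  refine le_antisymm (iSup₂_le fun u hu => Nat.cast_le.2 (h u hu)) ?_
  exact le_iSup₂ (f := fun u (_ : u ∈ S) => (indicator X u : ℕ∞)) w hw

end BifixCode

/-! ### The embedding theorem -/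

open BifixCode in
theorem mainTheorem7 {A : Type*} [Finite A] [Nonempty A] (S : Set (List A))
    (hS : BifixCode.IsRecurrent S) (X : Set (List A)) (d : ℕ∞)
    (hthin : BifixCode.IsThin S X) (hmax : BifixCode.IsMaximalBifixCode S X)
    (hdeg : BifixCode.degree S X = d) :
    ∃ X' : Set (List A), BifixCode.IsThin Set.univ X' ∧
      BifixCode.IsMaximalBifixCode Set.univ X' ∧
      BifixCode.degree Set.univ X' = d ∧ X = X' ∩ S := by
  have hX : IsBifixCode X := hmax.1.1
  obtain ⟨n, hn⟩ := hmax.exists_indicator_le hS hthin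
  obtain ⟨w, hw, hwmax⟩ := exists_max_of_bounded (hthin.2.imp fun _ h => h.1) hn
  have hI := isIndicator_indicator hX
  have hpos : 1 ≤ indicator X w := by
    rw [← hI.nil]
    exact hI.le_append_right [] w
  -- The truncation level is the maximum of the indicator on `S`, so values on `S` are unchanged.
  have hf := hI.min hpos
  have hfle : ∀ u, min (indicator X w) (indicator X u) ≤ indicator X w := fun u => min_le_left _ _
  refine ⟨_, hf.isThin_codeOf hfle (w := w) (min_self _),
    isMaximalBifixCode_univ_of_indicator_le hf.isBifixCode_codeOf
      (fun u => (hf.indicator_codeOf u).trans_le (hfle u)), ?_, ?_⟩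
  · have hw' := hf.indicator_codeOf w
    rw [min_self] at hw'
    rw [← hdeg, degree_eq_of_max hX.1 hw hwmax,
      degree_eq_of_max hf.isBifixCode_codeOf.1 (Set.mem_univ w), hw']
    intro u _
    rw [hw']
    exact (hf.indicator_codeOf u).trans_le (hfle u)
  · rw [codeOf_inter_congr hS.2.1 (g := indicator X) fun u hu => min_eq_right (hwmax u hu),
      codeOf_indicator hX, Set.inter_eq_left.2 hmax.1.2]
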